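/- Let $H$ be a real Hilbert space. A dictionary is a set $\mathcal D\subset H$ of vectors of norm one whose linear span is dense in $H$, and $A_1(\mathcal D)$ is the closure in $H$ of the convex hull of $\{\pm g: g\in\mathcal D\}$. Let $\tau=\{t_k\}_{k=1}^\infty$ be a weakness sequence, i.e. $t_k\in[0,1]$ for all $k$. For $f\in H$, a realization of the Weak Greedy Algorithm WGA($\tau$) with respect to $\mathcal D$ is an infinite sequence $\varphi_1,\varphi_2,\dots\in\mathcal D$ together with residuals $f_0:=f$, $f_m:=f_{m-1}-\langle f_{m-1},\varphi_m\rangle\varphi_m$, such that for every $m\ge1$ $$|\langle f_{m-1},\varphi_m\rangle|\ge t_m\sup_{g\in\mathcal D}|\langle f_{m-1},g\rangle|.$$ WGA($\tau$) is said to $A_1(\mathcal D)$-converge if $\lim_{m\to\infty}\|f_m\|=0$ for every $f\in A_1(\mathcal D)$ and every realization of WGA($\tau$) applied to $f$. Theorem. Assume that $\tau$ is monotone, $t_1\ge t_2\ge\cdots$. If $H$ is infinite-dimensional, then the condition $$\sum_{k=1}^\infty\frac{t_k}{k}=\infty$$ is necessary and sufficient for the $A_1(\mathcal D)$-convergence of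 WGA($\tau$) for all dictionaries $\mathcal D$ in $H$. The sufficiency also holds in every finite-dimensional $H$. -/

import Mathlib

open Filter Topology

/-- A sequence `t 1, t 2, …` of numbers in `[0, 1]`; the value `t 0` plays no role. -/
def IsWeaknessSequence (t : ℕ → ℝ) : Prop :=
  ∀ k, 1 ≤ k → 0 ≤ t k ∧ t k ≤ 1

section Greedy

variable {H : Type*} [NormedAddCommGroup H] [InnerProductSpace ℝ H]

/-- A dictionary: a set of unit vectors whose closed linear span is the whole space. -/
def IsDictionary (D : Set H) : Prop :=
  (∀ g ∈ D, ‖g‖ = 1) ∧ closure (Submodule.span ℝ D : Set H) = Set.univ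

/-- The generalized octahedron of `D`: the closed convex hull of the symmetrized set `{±g : g ∈ D}`. -/
def octahedron (D : Set H) : Set H :=
  closure (convexHull ℝ {x : H | ∃ g ∈ D, x = g ∨ x = -g})

/-- The residuals `f_0 = f`, `f_m = f_{m-1} - ⟨f_{m-1}, φ_m⟩ φ_m` produced by the chosen
elements `φ 1, φ 2, …` (the value `φ 0` plays no role). -/
noncomputable def wgaResidual (f : H) (φ : ℕ → H) : ℕ → H
  | 0 => f
  | m + 1 => wgaResidual f φ m - inner ℝ (wgaResidual f φ m) (φ (m + 1)) • φ (m + 1)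

/-- `φ 1, φ 2, …` are the elements of `D` chosen in a realization of the Weak Greedy Algorithm with
weakness sequence `t`, applied to `f`. The supremum is over a set bounded by the norm of the
residual as soon as `D` consists of unit vectors. -/
def IsWGARealization (D : Set H) (t : ℕ → ℝ) (f : H) (φ : ℕ → H) : Prop :=
  ∀ m, 1 ≤ m → φ m ∈ D ∧
    t m * (⨆ g : D, |inner ℝ (wgaResidual f φ (m - 1)) (g : H)|)
      ≤ |inner ℝ (wgaResidual f φ (m - 1)) (φ m)|

/-- The Weak Greedy Algorithm with weakness sequence `t` converges on the generalized octahedron of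
`D`: for each `f` in it and each realization, the norms of the residuals tend to zero. -/
def WGAOctahedronConverges (D : Set H) (t : ℕ → ℝ) : Prop :=
  ∀ f ∈ octahedron D, ∀ φ : ℕ → H, IsWGARealization D t f φ →
    Tendsto (fun m => ‖wgaResidual f φ m‖) atTop (𝓝 0)

end Greedy

/-! Sufficiency: suppose the residual norms decrease to c > 0, and let y_k be the modulus of the
k-th coefficient. The y_k are square summable, and f_m lies in (1 + y_1 + ... + y_m) times the
octahedron, whence c² t_k ≤ y_k (1 + y_1 + ... + y_k). Dividing by k and summing,
`sum_mul_average_le` bounds the partial sums of t_k / k.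

Necessity: if the series converges, condensation makes the sum of t(2^s) finite. In the plane
dictionary, n projections, each turning by π/(4n), split a coefficient R into two equal ones
slightly below R/√2 (`HasCoeffs.rotate`). They are admissible when t is at most about 1/n, and they
lose only a fraction O(1/n) of the norm. Doubling 2^s coefficients takes at least 2^s steps, so
level s only sees weakness parameters at most t(2^s). With 1/n_s of order t(2^s) + 2^(-s) the losses
are summable and the residuals stay away from zero. -/

/-! ### Hardy's inequality -/

/-- A form of Hardy's inequality: an `ℓ²` sequence pairs to a convergent series with the sequence
of its averages, shifted by a constant. -/
theorem sum_mul_average_le (y : ℕ → ℝ) (n : ℕ) :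
    ∑ k ∈ Finset.range n, y (k + 1) * (1 + ∑ j ∈ Finset.range (k + 1), y (j + 1)) / (k + 1)
      ≤ 3 * ∑ k ∈ Finset.range n, y (k + 1) ^ 2 + 2 := by
  -- Subtracting half of (sum)² / (number of terms) gives a potential that lets the induction close.
  suffices h : ∀ n : ℕ,
      ∑ k ∈ Finset.range (n + 1), y (k + 1) * (1 + ∑ j ∈ Finset.range (k + 1), y (j + 1)) / (k + 1)
        ≤ 3 * ∑ k ∈ Finset.range (n + 1), y (k + 1) ^ 2 + 2
          - (1 + ∑ j ∈ Finset.range (n + 1), y (j + 1)) ^ 2 / (n + 1) / 2 by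
    cases n with
    | zero => simp
    | succ n =>
      refine (h n).trans (sub_le_self _ ?_)
      positivity
  intro n
  induction n with
  | zero =>
    simp
    nlinarith [sq_nonneg (y 1 - 1)]
  | succ n ih =>
    have hB' : 1 + ∑ j ∈ Finset.range (n + 1 + 1), y (j + 1) =
        1 + ∑ j ∈ Finset.range (n + 1), y (j + 1) + y (n + 1 + 1) := by
      rw [Finset.sum_range_succ _ (n + 1)]
      exact (add_assoc _ _ _).symm
    rw [Finset.sum_range_succ (fun k => y (k + 1) * _ / _) (n + 1),
      Finset.sum_range_succ (fun k => y (k + 1) ^ 2) (n + 1), hB']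
    set B := 1 + ∑ j ∈ Finset.range (n + 1), y (j + 1)
    set z := y (n + 1 + 1)
    push_cast
    have hN : (0 : ℝ) < n + 1 := by positivity
    set N : ℝ := (n : ℝ) + 1 with hNdef
    set A := (B + z) / (N + 1) with hA
    have hBA : B = (N + 1) * A - z := by rw [hA]; field_simp; ring
    have h1 : z * (B + z) / (N + 1) = z * A := by rw [hA]; ring
    have h2 : (B + z) ^ 2 / (N + 1) = (N + 1) * A ^ 2 := by rw [hA]; field_simp
    have h3 : B ^ 2 / N = (N + 1) * A ^ 2 + A ^ 2 - 2 * A * z + (A - z) ^ 2 / N := by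
      rw [hBA]; field_simp; ring
    have h4 : 0 ≤ (A - z) ^ 2 / N := by positivity
    rw [h1, h2]
    rw [h3] at ih
    nlinarith [sq_nonneg (A - 2 * z)]

/-! ### Sufficiency -/

section Greedy

variable {H : Type*} [NormedAddCommGroup H] [InnerProductSpace ℝ H]

theorem abs_inner_le_iSup {D : Set H} (hD : ∀ g ∈ D, ‖g‖ = 1) (f : H) {g : H} (hg : g ∈ D) :
    |inner ℝ f g| ≤ ⨆ g : D, |inner ℝ f (g : H)| := by
  refine le_ciSup (f := fun g : D => |inner ℝ f (g : H)|) ⟨‖f‖, ?_⟩ ⟨g, hg⟩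
  rintro _ ⟨g, rfl⟩
  simpa [hD g g.2] using abs_real_inner_le_norm f (g : H)

theorem abs_inner_le_of_mem_octahedron {D : Set H} {f x : H} {S : ℝ}
    (hS : ∀ g ∈ D, |inner ℝ f g| ≤ S) (hx : x ∈ octahedron D) : inner ℝ f x ≤ S := by
  have hcl : IsClosed {x : H | inner ℝ f x ≤ S} :=
    isClosed_le (by fun_prop) continuous_const
  have hconv : Convex ℝ {x : H | inner ℝ f x ≤ S} :=
    convex_halfSpace_le (innerSL ℝ f).toLinearMap.isLinear S
  refine closure_minimal (convexHull_min ?_ hconv) hcl hx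
  rintro x ⟨g, hg, rfl | rfl⟩
  · exact (le_abs_self _).trans (hS _ hg)
  · simpa using (neg_le_abs _).trans (hS _ hg)

theorem wgaResidual_succ (f : H) (φ : ℕ → H) (m : ℕ) :
    wgaResidual f φ (m + 1) =
      wgaResidual f φ m - inner ℝ (wgaResidual f φ m) (φ (m + 1)) • φ (m + 1) := rfl

theorem norm_sq_wgaResidual_succ (f : H) (φ : ℕ → H) (m : ℕ) (h : ‖φ (m + 1)‖ = 1) :
    ‖wgaResidual f φ (m + 1)‖ ^ 2 =
      ‖wgaResidual f φ m‖ ^ 2 - inner ℝ (wgaResidual f φ m) (φ (m + 1)) ^ 2 := by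
  rw [wgaResidual_succ, norm_sub_sq_real, inner_smul_right, norm_smul, h, mul_one,
    Real.norm_eq_abs, sq_abs]
  ring

/-- Each step subtracts a multiple of a dictionary element, so the residual stays in the octahedron
dilated by 1 plus the moduli used so far. With h the residual itself this bounds its squared norm.
-/
theorem inner_wgaResidual_le {D : Set H} {f h : H} {φ : ℕ → H} {S : ℝ}
    (hS : ∀ g ∈ D, |inner ℝ h g| ≤ S) (hf : f ∈ octahedron D) (hφ : ∀ m, φ (m + 1) ∈ D) (m : ℕ) :
    inner ℝ h (wgaResidual f φ m) ≤
      S * (1 + ∑ j ∈ Finset.range m, |inner ℝ (wgaResidual f φ j) (φ (j + 1))|) := by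
  induction m with
  | zero => simpa [wgaResidual] using abs_inner_le_of_mem_octahedron hS hf
  | succ m ih =>
    rw [wgaResidual_succ, inner_sub_right, inner_smul_right, Finset.sum_range_succ]
    have h1 : -(inner ℝ (wgaResidual f φ m) (φ (m + 1)) * inner ℝ h (φ (m + 1)))
        ≤ |inner ℝ (wgaResidual f φ m) (φ (m + 1))| * S := by
      refine (neg_le_abs _).trans ?_
      rw [abs_mul]
      exact mul_le_mul_of_nonneg_left (hS _ (hφ m)) (abs_nonneg _)
    linarith

theorem WGAOctahedronConverges.of_tendsto {D : Set H} (hD : ∀ g ∈ D, ‖g‖ = 1) {t : ℕ → ℝ}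
    (ht : IsWeaknessSequence t)
    (hdiv : Tendsto (fun n : ℕ => ∑ k ∈ Finset.Icc 1 n, t k / (k : ℝ)) atTop atTop) :
    WGAOctahedronConverges D t := by
  intro f hf φ hφ
  set r := wgaResidual f φ with hr
  have hφD : ∀ m, φ (m + 1) ∈ D := fun m => (hφ (m + 1) (by omega)).1
  have hstep : ∀ m, ‖r (m + 1)‖ ^ 2 = ‖r m‖ ^ 2 - inner ℝ (r m) (φ (m + 1)) ^ 2 := fun m =>
    norm_sq_wgaResidual_succ f φ m (hD _ (hφD m))
  have hanti : Antitone fun m => ‖r m‖ := antitone_nat_of_succ_le fun m =>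
    (sq_le_sq₀ (norm_nonneg _) (norm_nonneg _)).1 (by nlinarith [hstep m, sq_nonneg (inner ℝ (r m) (φ (m + 1)))])
  have hbdd : BddBelow (Set.range fun m => ‖r m‖) := ⟨0, by rintro _ ⟨m, rfl⟩; positivity⟩
  have hlim := tendsto_atTop_ciInf hanti hbdd
  set c := ⨅ m, ‖r m‖ with hc
  have hcle : ∀ m, c ≤ ‖r m‖ := fun m => ciInf_le hbdd m
  have hc0 : 0 ≤ c := le_ciInf fun m => norm_nonneg _
  rcases hc0.eq_or_lt with h0 | hcpos
  · rwa [← h0] at hlim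
  exfalso
  set y : ℕ → ℝ := fun k => |inner ℝ (r (k - 1)) (φ k)| with hy
  have hsq : ∀ n, ∑ k ∈ Finset.range n, y (k + 1) ^ 2 ≤ ‖f‖ ^ 2 := by
    intro n
    have : ∑ k ∈ Finset.range n, y (k + 1) ^ 2 = ‖r 0‖ ^ 2 - ‖r n‖ ^ 2 := by
      rw [← Finset.sum_range_sub' (fun k => ‖r k‖ ^ 2)]
      refine Finset.sum_congr rfl fun k _ => ?_
      simp [hy, hstep, sq_abs]
    rw [this]
    have : r 0 = f := rfl
    rw [this]
    nlinarith [sq_nonneg ‖r n‖]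
  have hkey : ∀ k : ℕ, c ^ 2 * t (k + 1) ≤
      y (k + 1) * (1 + ∑ j ∈ Finset.range (k + 1), y (j + 1)) := by
    intro k
    set S := ⨆ g : D, |inner ℝ (r k) (g : H)| with hS
    have h1 : ‖r k‖ ^ 2 ≤ S * (1 + ∑ j ∈ Finset.range k, y (j + 1)) := by
      have := inner_wgaResidual_le (h := r k) (fun g hg => abs_inner_le_iSup hD (r k) hg) hf hφD k
      rw [← hr, real_inner_self_eq_norm_sq] at this
      simpa [hy] using this
    have h2 : t (k + 1) * S ≤ y (k + 1) := (hφ (k + 1) (by omega)).2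
    have ht0 := (ht (k + 1) (by omega)).1
    have hB : 0 ≤ 1 + ∑ j ∈ Finset.range k, y (j + 1) :=
      add_nonneg zero_le_one (Finset.sum_nonneg fun j _ => abs_nonneg _)
    have hcr : c ^ 2 ≤ ‖r k‖ ^ 2 := by gcongr; exact hcle k
    have hy0 : 0 ≤ y (k + 1) := abs_nonneg _
    calc c ^ 2 * t (k + 1) ≤ (S * (1 + ∑ j ∈ Finset.range k, y (j + 1))) * t (k + 1) := by
          gcongr; exact hcr.trans h1
      _ = (t (k + 1) * S) * (1 + ∑ j ∈ Finset.range k, y (j + 1)) := by ring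
      _ ≤ y (k + 1) * (1 + ∑ j ∈ Finset.range k, y (j + 1)) := by gcongr
      -- Including the current term y_{k+1} only enlarges the sum, and matches the averages in
      -- Hardy's inequality.
      _ ≤ _ := by
        rw [Finset.sum_range_succ]
        gcongr
        linarith
  have hbound : ∀ n : ℕ, ∑ k ∈ Finset.Icc 1 n, t k / (k : ℝ) ≤ (3 * ‖f‖ ^ 2 + 2) / c ^ 2 := by
    intro n
    rw [le_div_iff₀ (by positivity), Finset.sum_mul]
    have : ∑ k ∈ Finset.Icc 1 n, t k / (k : ℝ) * c ^ 2 =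
        ∑ k ∈ Finset.range n, c ^ 2 * t (k + 1) / (k + 1) := by
      rw [Finset.sum_bij' (fun k _ => k - 1) (fun k _ => k + 1)]
      all_goals intro k hk
      all_goals simp only [Finset.mem_Icc, Finset.mem_range] at hk ⊢
      any_goals omega
      obtain ⟨k, rfl⟩ := Nat.exists_eq_add_of_le' hk.1
      push_cast
      ring
    rw [this]
    calc _ ≤ ∑ k ∈ Finset.range n,
          y (k + 1) * (1 + ∑ j ∈ Finset.range (k + 1), y (j + 1)) / (k + 1) := by
          refine Finset.sum_le_sum fun k _ => ?_
          exact div_le_div_of_nonneg_right (hkey k) (by positivity)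
      _ ≤ _ := (sum_mul_average_le y n).trans (by linarith [hsq n])
  obtain ⟨n, hn⟩ := (hdiv.eventually (eventually_gt_atTop ((3 * ‖f‖ ^ 2 + 2) / c ^ 2))).exists
  exact absurd (hbound n) (not_le.2 hn)

end Greedy

/-! ### Realizations from invariants, and an orthonormal sequence -/

/-- A realization exists along which an invariant holds, if the invariant can be maintained by
admissible steps. -/
theorem exists_realization_of_invariant {H : Type*} [NormedAddCommGroup H] [InnerProductSpace ℝ H]
    {D : Set H} {t : ℕ → ℝ} {f : H} (Inv : ℕ → H → Prop) (h0 : Inv 0 f)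
    (hstep : ∀ m h, Inv m h → ∃ g ∈ D,
      t (m + 1) * (⨆ g : D, |inner ℝ h (g : H)|) ≤ |inner ℝ h g| ∧
      Inv (m + 1) (h - inner ℝ h g • g)) :
    ∃ φ, IsWGARealization D t f φ ∧ ∀ m, Inv m (wgaResidual f φ m) := by
  classical
  choose! G hGD hG hGI using hstep
  let r : ℕ → H := fun m => Nat.rec f (fun m h => h - inner ℝ h (G m h) • G m h) m
  let φ : ℕ → H := fun m => G (m - 1) (r (m - 1))
  have hr : ∀ m, wgaResidual f φ m = r m := by
    intro m
    induction m with
    | zero => rfl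
    | succ m ih => simp only [wgaResidual, ih]; rfl
  have hI : ∀ m, Inv m (r m) := by
    intro m
    induction m with
    | zero => exact h0
    | succ m ih => exact hGI m _ ih
  refine ⟨φ, ?_, fun m => (hr m).symm ▸ hI m⟩
  intro m hm
  obtain ⟨m, rfl⟩ := Nat.exists_eq_add_of_le' hm
  rw [hr]
  exact ⟨hGD m _ (hI m), hG m _ (hI m)⟩

theorem exists_orthonormal_nat (H : Type*) [NormedAddCommGroup H] [InnerProductSpace ℝ H]
    [CompleteSpace H] (hinf : ¬ FiniteDimensional ℝ H) : ∃ e : ℕ → H, Orthonormal ℝ e := by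
  obtain ⟨w, b, hb⟩ := exists_hilbertBasis ℝ H
  have hw : Infinite w := by
    by_contra hfin
    rw [not_infinite_iff_finite] at hfin
    have := Fintype.ofFinite w
    exact hinf (Module.Basis.finiteDimensional_of_finite b.toOrthonormalBasis.toBasis)
  exact ⟨_, b.orthonormal.comp _ (Infinite.natEmbedding w).injective⟩

/-! ### The plane dictionary -/

section PlaneDictionary

variable {H : Type*} [NormedAddCommGroup H] [InnerProductSpace ℝ H]

/-- The unit vectors lying in a plane spanned by two members of `e`, and those orthogonal to all
members of `e`. -/
def planeDictionary (e : ℕ → H) : Set H :=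
  {g | ∃ p q : ℕ, p ≠ q ∧ ∃ θ : ℝ, g = Real.cos θ • e p + Real.sin θ • e q} ∪
    {g | ‖g‖ = 1 ∧ ∀ j, inner ℝ (e j) g = 0}

theorem mem_planeDictionary (e : ℕ → H) (j : ℕ) : e j ∈ planeDictionary e :=
  Or.inl ⟨j, j + 1, by simp, 0, by simp⟩

/-- For density: a nonzero vector orthogonal to the dictionary is orthogonal to every `e j`, so its
normalization belongs to the dictionary, a contradiction. -/
theorem isDictionary_planeDictionary [CompleteSpace H] {e : ℕ → H} (he : Orthonormal ℝ e) :
    IsDictionary (planeDictionary e) := by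
  constructor
  · rintro g (⟨p, q, hpq, θ, rfl⟩ | ⟨h, -⟩)
    · have : ‖Real.cos θ • e p + Real.sin θ • e q‖ ^ 2 = 1 := by
        rw [norm_add_sq_real, norm_smul, norm_smul, he.1, he.1, inner_smul_left, inner_smul_right,
          he.2 hpq]
        simp
      exact (pow_eq_one_iff_of_nonneg (norm_nonneg _) two_ne_zero).1 this
    · exact h
  · rw [← Submodule.topologicalClosure_coe, ← Submodule.top_coe (R := ℝ), SetLike.coe_set_eq,
      Submodule.topologicalClosure_eq_top_iff, Submodule.eq_bot_iff]
    intro x hx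
    have hx' : ∀ g ∈ planeDictionary e, inner ℝ g x = 0 := fun g hg =>
      (Submodule.mem_orthogonal _ _).1 hx g (Submodule.subset_span hg)
    by_contra hne
    have hn : ‖x‖ ≠ 0 := norm_ne_zero_iff.2 hne
    have := hx' (‖x‖⁻¹ • x) (Or.inr ⟨by rw [norm_smul, norm_inv, norm_norm, inv_mul_cancel₀ hn],
      fun j => by rw [inner_smul_right, hx' _ (mem_planeDictionary e j), mul_zero]⟩)
    rw [inner_smul_left, real_inner_self_eq_norm_sq] at this
    simp [hn] at this

/-- `f` lies in the closed span of `e` and has coefficients `X` there. -/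
def HasCoeffs (e : ℕ → H) (f : H) (X : ℕ → ℝ) : Prop :=
  (∀ j, inner ℝ f (e j) = X j) ∧ ∀ g, (∀ j, inner ℝ (e j) g = 0) → inner ℝ f g = 0

theorem HasCoeffs.inner_plane {e : ℕ → H} {f : H} {X : ℕ → ℝ} (hf : HasCoeffs e f X)
    (p q : ℕ) (θ : ℝ) :
    inner ℝ f (Real.cos θ • e p + Real.sin θ • e q) = Real.cos θ * X p + Real.sin θ * X q := by
  rw [inner_add_right, inner_smul_right, inner_smul_right, hf.1, hf.1]

theorem abs_cos_add_abs_sin_le (θ : ℝ) : |Real.cos θ| + |Real.sin θ| ≤ √2 := by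
  refine Real.le_sqrt_of_sq_le ?_
  nlinarith [sq_nonneg (|Real.cos θ| - |Real.sin θ|), sq_abs (Real.cos θ), sq_abs (Real.sin θ),
    Real.sin_sq_add_cos_sq θ]

theorem HasCoeffs.iSup_le {e : ℕ → H} {f : H} {X : ℕ → ℝ} (hf : HasCoeffs e f X) {R : ℝ}
    (hX : ∀ j, |X j| ≤ R) : ⨆ g : planeDictionary e, |inner ℝ f (g : H)| ≤ √2 * R := by
  have hR : 0 ≤ R := (abs_nonneg _).trans (hX 0)
  refine Real.iSup_le ?_ (by positivity)
  rintro ⟨g, ⟨p, q, -, θ, rfl⟩ | ⟨-, hg⟩⟩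
  · simp only [hf.inner_plane]
    calc _ ≤ |Real.cos θ * X p| + |Real.sin θ * X q| := abs_add_le _ _
      _ ≤ |Real.cos θ| * R + |Real.sin θ| * R := by
        rw [abs_mul, abs_mul]; gcongr <;> exact hX _
      _ = (|Real.cos θ| + |Real.sin θ|) * R := by ring
      _ ≤ √2 * R := by gcongr; exact abs_cos_add_abs_sin_le θ
  · simp only [hf.2 g hg, abs_zero]
    positivity

theorem HasCoeffs.step {e : ℕ → H} (he : Orthonormal ℝ e) {f : H} {X Y : ℕ → ℝ}
    (hf : HasCoeffs e f X) {p q : ℕ} (hpq : p ≠ q) (θ : ℝ)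
    (hp : Y p = X p - (Real.cos θ * X p + Real.sin θ * X q) * Real.cos θ)
    (hq : Y q = X q - (Real.cos θ * X p + Real.sin θ * X q) * Real.sin θ)
    (hY : ∀ j, j ≠ p → j ≠ q → Y j = X j) :
    HasCoeffs e (f - inner ℝ f (Real.cos θ • e p + Real.sin θ • e q) •
      (Real.cos θ • e p + Real.sin θ • e q)) Y := by
  have hee := orthonormal_iff_ite.1 he
  constructor
  · intro j
    rw [hf.inner_plane, inner_sub_left, inner_smul_left, inner_add_left, inner_smul_left,
      inner_smul_left, hf.1, hee, hee]
    by_cases h1 : j = p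
    · subst h1; simp [hpq.symm, hp]
    · by_cases h2 : j = q
      · subst h2; simp [hpq, hq]
      · simp [Ne.symm h1, Ne.symm h2, hY j h1 h2]
  · intro g hg
    rw [inner_sub_left, inner_smul_left, inner_add_left, inner_smul_left, inner_smul_left,
      hg, hg, hf.2 g hg]
    simp

theorem HasCoeffs.card_mul_sq_le {e : ℕ → H} (he : Orthonormal ℝ e) {f : H} {X : ℕ → ℝ}
    (hf : HasCoeffs e f X) {c : ℝ} (hc : 0 ≤ c) {n : ℕ} (hX : ∀ j < n, c ≤ X j) :
    n * c ^ 2 ≤ ‖f‖ ^ 2 := by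
  refine le_trans ?_ (he.sum_inner_products_le f (s := Finset.range n))
  calc (n : ℝ) * c ^ 2 = ∑ j ∈ Finset.range n, c ^ 2 := by simp
    _ ≤ _ := Finset.sum_le_sum fun j hj => by
      rw [real_inner_comm, hf.1, Real.norm_eq_abs, sq_abs]
      have := hX j (Finset.mem_range.1 hj)
      gcongr

theorem hasCoeffs_sum {e : ℕ → H} (he : Orthonormal ℝ e) (c : ℝ) (n : ℕ) :
    HasCoeffs e (∑ j ∈ Finset.range n, c • e j) (fun j => if j < n then c else 0) := by
  have hee := orthonormal_iff_ite.1 he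
  constructor
  · intro j
    simp [sum_inner, inner_smul_left, hee]
  · intro g hg
    simp [sum_inner, inner_smul_left, hg]

theorem sum_mem_octahedron (e : ℕ → H) {n : ℕ} (hn : 0 < n) :
    ∑ j ∈ Finset.range n, (n : ℝ)⁻¹ • e j ∈ octahedron (planeDictionary e) := by
  refine subset_closure ((convex_convexHull ℝ _).sum_mem (fun _ _ => by positivity) ?_
    fun j _ => subset_convexHull ℝ _ ⟨e j, mem_planeDictionary e j, Or.inl rfl⟩)
  have : (n : ℝ) ≠ 0 := by positivity
  simp [this]

end PlaneDictionary

/-! ### Splitting a coefficient by small rotations -/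

section Splitting

open Real

theorem pi_div_four_mul_mem {n : ℕ} (hn : 1 ≤ n) : 0 ≤ π / (4 * n) ∧ π / (4 * n) ≤ π / 4 := by
  have hn' : (1 : ℝ) ≤ n := by exact_mod_cast hn
  refine ⟨by positivity, ?_⟩
  gcongr
  linarith

theorem one_div_two_mul_le_sin {n : ℕ} (hn : 1 ≤ n) : 1 / (2 * n : ℝ) ≤ sin (π / (4 * n)) := by
  obtain ⟨h0, h1⟩ := pi_div_four_mul_mem hn
  have := mul_le_sin h0 (h1.trans (by linarith [pi_pos]))
  have hn' : (n : ℝ) ≠ 0 := by positivity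
  refine le_trans (le_of_eq ?_) this
  field_simp
  norm_num

/-- One rotation loses O(1/n²), so n of them lose O(1/n): combine cos x ≥ 1 - x²/2, π ≤ 4 and
Bernoulli's inequality. -/
theorem one_sub_le_cos_pow {n : ℕ} (hn : 1 ≤ n) :
    1 - 1 / (2 * n : ℝ) ≤ cos (π / (4 * n)) ^ n := by
  have hn' : (1 : ℝ) ≤ n := by exact_mod_cast hn
  have hcos := one_sub_sq_div_two_le_cos (x := π / (4 * n))
  have hpi : π ^ 2 ≤ 16 := by nlinarith [pi_pos, pi_le_four]
  have hx : (π / (4 * n)) ^ 2 / 2 ≤ 1 / (2 * n ^ 2 : ℝ) := by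
    rw [div_pow, div_div, div_le_div_iff₀ (by positivity) (by positivity)]
    nlinarith [sq_nonneg (n : ℝ)]
  have hx1 : 1 / (2 * n ^ 2 : ℝ) ≤ 1 := by
    rw [div_le_one (by positivity)]
    nlinarith
  calc 1 - 1 / (2 * n : ℝ) = 1 + n * (-(1 / (2 * n ^ 2 : ℝ))) := by field_simp; ring
    _ ≤ (1 + -(1 / (2 * n ^ 2 : ℝ))) ^ n := one_add_mul_le_pow (by linarith) n
    _ ≤ _ := by gcongr <;> linarith

theorem cos_pi_div_four_mul_mem {n : ℕ} (hn : 1 ≤ n) :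
    0 ≤ cos (π / (4 * n)) ∧ cos (π / (4 * n)) ≤ 1 := by
  obtain ⟨h0, h1⟩ := pi_div_four_mul_mem hn
  exact ⟨cos_nonneg_of_mem_Icc ⟨by linarith [pi_pos], by linarith [pi_pos]⟩, cos_le_one _⟩

theorem half_le_cos_pow {n k : ℕ} (hn : 1 ≤ n) (hk : k ≤ n) :
    1 / 2 ≤ cos (π / (4 * n)) ^ k := by
  have hn' : (1 : ℝ) ≤ n := by exact_mod_cast hn
  have h1 : 1 / (2 * n : ℝ) ≤ 1 / 2 := by gcongr; linarith
  obtain ⟨hc0, hc1⟩ := cos_pi_div_four_mul_mem hn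
  linarith [one_sub_le_cos_pow hn, pow_le_pow_of_le_one hc0 hc1 hk]

/-- The coefficients in the course of replacing `N` coefficients `r` by `2 * N` coefficients `r'`:
the first `i` ones are done, and the next one has undergone `k` of `n` rotations. -/
noncomputable def splitCoeff (r r' : ℝ) (N i n k j : ℕ) : ℝ :=
  if j < N then
    if j < i then r' else if j = i then r * cos (π / (4 * n)) ^ k * cos (k * (π / (4 * n))) else r
  else
    if j < N + i then r' else
      if j = N + i then r * cos (π / (4 * n)) ^ k * sin (k * (π / (4 * n))) else 0

variable {r r' : ℝ} {N i n k : ℕ}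

theorem natCast_mul_mem (hn : 1 ≤ n) (hk : k ≤ n) :
    0 ≤ k * (π / (4 * n)) ∧ k * (π / (4 * n)) ≤ π / 4 := by
  have hn' : (0 : ℝ) < n := by exact_mod_cast hn
  have hk' : (k : ℝ) ≤ n := by exact_mod_cast hk
  refine ⟨by positivity, ?_⟩
  calc k * (π / (4 * n)) ≤ n * (π / (4 * n)) := by gcongr
    _ = π / 4 := by field_simp

theorem abs_splitCoeff_le (hn : 1 ≤ n) (h0 : 0 ≤ r') (h1 : r' ≤ r) (j : ℕ) :
    |splitCoeff r r' N i n k j| ≤ r := by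
  obtain ⟨hc0, hc1⟩ := cos_pi_div_four_mul_mem hn
  have hr : 0 ≤ r := h0.trans h1
  have hpow : r * cos (π / (4 * n)) ^ k ≤ r := mul_le_of_le_one_right hr (pow_le_one₀ hc0 hc1)
  have hpow0 : 0 ≤ r * cos (π / (4 * n)) ^ k := by positivity
  have key : ∀ x : ℝ, |x| ≤ 1 → |r * cos (π / (4 * n)) ^ k * x| ≤ r := fun x hx => by
    rw [abs_mul, abs_of_nonneg hpow0]
    exact (mul_le_of_le_one_right hpow0 hx).trans hpow
  unfold splitCoeff
  split_ifs
  · rwa [abs_of_nonneg h0]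
  · exact key _ (abs_cos_le_one _)
  · rw [abs_of_nonneg hr]
  · rwa [abs_of_nonneg h0]
  · exact key _ (abs_sin_le_one _)
  · simpa using hr

theorem le_splitCoeff (hn : 1 ≤ n) (hk : k ≤ n) (hr : 0 ≤ r)
    (hr' : r' = r * cos (π / (4 * n)) ^ n * cos (π / 4)) (h1 : r' ≤ r) {j : ℕ} (hj : j < N) :
    r' ≤ splitCoeff r r' N i n k j := by
  obtain ⟨hc0, hc1⟩ := cos_pi_div_four_mul_mem hn
  obtain ⟨hk0, hk1⟩ := natCast_mul_mem hn hk
  unfold splitCoeff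
  rw [if_pos hj]
  split_ifs
  · exact le_rfl
  · rw [hr']
    have h2 : cos (π / 4) ≤ cos (k * (π / (4 * n))) :=
      cos_le_cos_of_nonneg_of_le_pi hk0 (by linarith [pi_pos]) hk1
    have h3 := pow_le_pow_of_le_one hc0 hc1 hk
    have h4 : 0 ≤ cos (π / 4) := by rw [cos_pi_div_four]; positivity
    gcongr
  · exact h1

theorem splitCoeff_end (hn : 1 ≤ n) (hr' : r' = r * cos (π / (4 * n)) ^ n * cos (π / 4)) :
    splitCoeff r r' N i n n = splitCoeff r r' N (i + 1) n 0 := by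
  have hn' : (n : ℝ) ≠ 0 := by positivity
  have h1 : (n : ℝ) * (π / (4 * n)) = π / 4 := by field_simp
  have h2 : r * cos (π / (4 * n)) ^ n * cos (n * (π / (4 * n))) = r' := by rw [h1, hr']
  have h3 : r * cos (π / (4 * n)) ^ n * sin (n * (π / (4 * n))) = r' := by
    rw [h1, hr', cos_pi_div_four, sin_pi_div_four]
  funext j
  simp only [splitCoeff, h2, h3]
  simp
  split_ifs <;> first | rfl | omega

/-- A completed level is the start of the next. The parameters `r''` and `n'` are free because no
rotation of that level has begun. -/
theorem splitCoeff_level (r'' : ℝ) (n' : ℕ) :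
    splitCoeff r r' N N n 0 = splitCoeff r' r'' (2 * N) 0 n' 0 := by
  funext j
  simp [splitCoeff]
  split_ifs <;> first | rfl | omega

theorem splitCoeff_start : splitCoeff r r' N 0 n 0 = fun j => if j < N then r else 0 := by
  funext j
  simp [splitCoeff]
  split_ifs <;> rfl

/-- In the plane of `e i` and `e (N + i)` the residual points at angle kδ. Removing its component at
angle (k+1)δ + π/2 leaves the projection onto angle (k+1)δ, shorter by the factor cos δ. -/
theorem HasCoeffs.rotate {H : Type*} [NormedAddCommGroup H] [InnerProductSpace ℝ H]
    {e : ℕ → H} (he : Orthonormal ℝ e) {f : H} (hi : i < N)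
    (hf : HasCoeffs e f (splitCoeff r r' N i n k)) :
    ∃ g ∈ planeDictionary e,
      inner ℝ f g = -(r * cos (π / (4 * n)) ^ k * sin (π / (4 * n))) ∧
      HasCoeffs e (f - inner ℝ f g • g) (splitCoeff r r' N i n (k + 1)) := by
  set δ := π / (4 * n) with hδ
  have hpq : i ≠ N + i := by omega
  have hp : splitCoeff r r' N i n k i = r * cos δ ^ k * cos (k * δ) := by
    simp [splitCoeff, hi, hδ]
  have hq : splitCoeff r r' N i n k (N + i) = r * cos δ ^ k * sin (k * δ) := by
    simp [splitCoeff, hδ]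
  have hp' : splitCoeff r r' N i n (k + 1) i = r * cos δ ^ (k + 1) * cos (k * δ + δ) := by
    simp [splitCoeff, hi, hδ, add_mul]
  have hq' : splitCoeff r r' N i n (k + 1) (N + i) = r * cos δ ^ (k + 1) * sin (k * δ + δ) := by
    simp [splitCoeff, hδ, add_mul]
  have hin : cos (k * δ + δ + π / 2) * (r * cos δ ^ k * cos (k * δ)) +
      sin (k * δ + δ + π / 2) * (r * cos δ ^ k * sin (k * δ)) = -(r * cos δ ^ k * sin δ) := by
    rw [cos_add_pi_div_two, sin_add_pi_div_two]
    have : sin δ = sin (k * δ + δ) * cos (k * δ) - cos (k * δ + δ) * sin (k * δ) := by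
      rw [← sin_sub]; ring_nf
    rw [this]
    ring
  refine ⟨_, Or.inl ⟨i, N + i, hpq, k * δ + δ + π / 2, rfl⟩, ?_, hf.step he hpq _ ?_ ?_ ?_⟩
  · rw [hf.inner_plane, hp, hq, hin]
  · rw [hp, hq, hin, hp', cos_add_pi_div_two]
    have : cos (k * δ) = cos (k * δ + δ) * cos δ + sin (k * δ + δ) * sin δ := by
      rw [← cos_sub]; ring_nf
    rw [this]
    ring
  · rw [hp, hq, hin, hq', sin_add_pi_div_two]
    have : sin (k * δ) = sin (k * δ + δ) * cos δ - cos (k * δ + δ) * sin δ := by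
      rw [← sin_sub]; ring_nf
    rw [this]
    ring
  · intro j h1 h2
    simp [splitCoeff, h1, h2]

/-- The direction at angle π/4 is parallel to (r, r), so one step annihilates both coefficients. -/
theorem HasCoeffs.cancel_pair {H : Type*} [NormedAddCommGroup H] [InnerProductSpace ℝ H]
    {e : ℕ → H} (he : Orthonormal ℝ e) {f : H}
    (hf : HasCoeffs e f fun j => if j < n + 2 then r else 0) :
    ∃ g ∈ planeDictionary e, inner ℝ f g = √2 * r ∧
      HasCoeffs e (f - inner ℝ f g • g) fun j => if j < n then r else 0 := by
  have h2 : √2 * √2 = 2 := mul_self_sqrt zero_le_two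
  refine ⟨_, Or.inl ⟨n, n + 1, by omega, π / 4, rfl⟩, ?_, hf.step he (by omega) _ ?_ ?_ ?_⟩
  · rw [hf.inner_plane, cos_pi_div_four, sin_pi_div_four]
    simp
    ring
  · simp
    linear_combination r / 2 * h2
  · simp
    linear_combination r / 2 * h2
  · intro j h1 h2
    by_cases h : j < n
    · simp [h, show j < n + 2 by omega]
    · simp [h, show ¬ j < n + 2 by omega]

end Splitting

/-! ### Choice of rotation numbers and amplitudes -/

theorem IsWeaknessSequence.nonneg_div {t : ℕ → ℝ} (ht : IsWeaknessSequence t) (k : ℕ) :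
    0 ≤ t k / (k : ℝ) := by
  cases k with
  | zero => simp
  | succ k => exact div_nonneg (ht _ (by omega)).1 (by positivity)

theorem IsWeaknessSequence.summable_dyadic {t : ℕ → ℝ} (ht : IsWeaknessSequence t)
    (hmono : ∀ k, 1 ≤ k → t (k + 1) ≤ t k)
    (h : ¬ Tendsto (fun n : ℕ => ∑ k ∈ Finset.Icc 1 n, t k / (k : ℝ)) atTop atTop) :
    Summable fun s : ℕ => t (2 ^ s) := by
  have hanti : ∀ m n, 1 ≤ m → m ≤ n → t n ≤ t m := fun m n hm hmn => by
    induction n, hmn using Nat.le_induction with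
    | base => exact le_rfl
    | succ n hn ih => exact (hmono n (hm.trans hn)).trans ih
  have hs : Summable fun k : ℕ => t k / (k : ℝ) := by
    by_contra hs
    rw [not_summable_iff_tendsto_nat_atTop_of_nonneg ht.nonneg_div] at hs
    refine h ((hs.comp (tendsto_add_atTop_nat 1)).congr fun n => ?_)
    rw [Function.comp_apply, Finset.range_eq_Ico, Finset.sum_eq_sum_Ico_succ_bot (by omega)]
    simp [← Finset.Ico_add_one_right_eq_Icc]
  rw [← summable_condensed_iff_of_nonneg ht.nonneg_div] at hs
  · refine hs.congr fun s => ?_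
    push_cast
    field_simp
  · intro m n hm hmn
    have := (ht n (by omega)).1
    have := (ht m (by omega)).1
    gcongr
    exact hanti m n hm hmn

theorem one_sub_sum_le_prod {ι : Type*} (S : Finset ι) (u v : ι → ℝ)
    (hu0 : ∀ i, 0 ≤ u i) (hu1 : ∀ i, u i ≤ 1) (huv : ∀ i, 1 - v i ≤ u i) :
    1 - ∑ i ∈ S, v i ≤ ∏ i ∈ S, u i := by
  classical
  induction S using Finset.induction_on with
  | empty => simp
  | insert i S hi ih =>
    rw [Finset.sum_insert hi, Finset.prod_insert hi]
    have h1 : ∏ i ∈ S, u i ≤ 1 := Finset.prod_le_one (fun i _ => hu0 i) fun i _ => hu1 i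
    nlinarith [hu0 i, hu1 i, huv i]

/-- The numbers of rotations to be used at each dyadic level. -/
theorem exists_rotation_numbers {t : ℕ → ℝ} (ht : IsWeaknessSequence t)
    (hs : Summable fun s : ℕ => t (2 ^ s)) :
    ∃ (s₀ : ℕ) (n : ℕ → ℕ), (∀ s, 1 ≤ n s) ∧ (∀ s, s₀ ≤ s → 6 * t (2 ^ s) ≤ 1 / n s) ∧
      ∀ s, ∑ p ∈ Finset.Ico s₀ s, 1 / (2 * n p : ℝ) ≤ 1 / 2 := by
  have ht0 : ∀ s : ℕ, 0 ≤ t (2 ^ s) := fun s => (ht _ Nat.one_le_two_pow).1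
  -- The geometric term keeps `a s` positive, so that 1/(6a) is meaningful even where t vanishes.
  set a : ℕ → ℝ := fun s => t (2 ^ s) + (1 / 2) ^ s with ha
  have hapos : ∀ s, 0 < a s := fun s => add_pos_of_nonneg_of_pos (ht0 s) (by positivity)
  have hsum : Summable a := hs.add summable_geometric_two
  -- The rotation loss 1/(2n) will be at most 6a, so a tail of 1/12 gives total loss at most 1/2.
  obtain ⟨s₀, hs₀⟩ := ((tendsto_sum_nat_add a).eventually
    (eventually_le_nhds (show (0 : ℝ) < 1 / 12 by norm_num))).exists
  have htail : ∀ s, ∑ p ∈ Finset.Ico s₀ s, a p ≤ 1 / 12 := by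
    intro s
    rw [Finset.sum_Ico_eq_sum_range]
    refine le_trans ?_ hs₀
    simp_rw [add_comm s₀]
    exact ((summable_nat_add_iff s₀).2 hsum).sum_le_tsum _ fun k _ => (hapos _).le
  have hasmall : ∀ s, s₀ ≤ s → a s ≤ 1 / 12 := fun s hs => by
    refine le_trans ?_ (htail (s + 1))
    exact Finset.single_le_sum (f := a) (fun p _ => (hapos p).le) (by simp [hs])
  refine ⟨s₀, fun s => max 1 ⌊1 / (6 * a s)⌋₊, fun s => le_max_left _ _, ?_, ?_⟩
  · intro s hs
    have h1 := hasmall s hs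
    have h2 := hapos s
    have hx : 1 ≤ 1 / (6 * a s) := by rw [le_div_iff₀ (by positivity)]; linarith
    have hle : ((max 1 ⌊1 / (6 * a s)⌋₊ : ℕ) : ℝ) ≤ 1 / (6 * a s) := by
      push_cast
      exact max_le hx (Nat.floor_le (by positivity))
    have hpos : (0 : ℝ) < (max 1 ⌊1 / (6 * a s)⌋₊ : ℕ) := by positivity
    rw [le_div_iff₀ hpos]
    rw [le_div_iff₀ (by positivity)] at hle
    have : t (2 ^ s) ≤ a s := by simp [ha]
    nlinarith
  · intro s
    have hterm : ∀ p, 1 / (2 * (max 1 ⌊1 / (6 * a p)⌋₊ : ℕ) : ℝ) ≤ 6 * a p := by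
      intro p
      have h2 := hapos p
      set x := 1 / (6 * a p) with hx
      have hxpos : 0 < x := by positivity
      have : x ≤ 2 * (max 1 ⌊x⌋₊ : ℕ) := by
        have h3 := (Nat.lt_floor_add_one x).le
        push_cast
        linarith [le_max_left (1 : ℝ) ⌊x⌋₊, le_max_right (1 : ℝ) ⌊x⌋₊]
      calc _ ≤ 1 / x := by gcongr
        _ = 6 * a p := by rw [hx]; field_simp
    calc _ ≤ ∑ p ∈ Finset.Ico s₀ s, 6 * a p := Finset.sum_le_sum fun p _ => hterm p
      _ = 6 * ∑ p ∈ Finset.Ico s₀ s, a p := by rw [Finset.mul_sum]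
      _ ≤ 1 / 2 := by linarith [htail s]

open Real in
/-- The amplitudes at the dyadic levels, when each rotation number is `n s`. -/
theorem exists_amplitudes {n : ℕ → ℕ} (hn : ∀ s, 1 ≤ n s) (s₀ : ℕ)
    (hsum : ∀ s, ∑ p ∈ Finset.Ico s₀ s, 1 / (2 * n p : ℝ) ≤ 1 / 2) {r : ℝ} (hr : 0 < r) :
    ∃ R : ℕ → ℝ, R s₀ = r ∧ (∀ s, 0 < R s) ∧
      (∀ s, s₀ ≤ s → R (s + 1) = R s * cos (π / (4 * n s)) ^ n s * cos (π / 4)) ∧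
      ∀ s, s₀ ≤ s → r ^ 2 / 4 ≤ 2 ^ s * R s ^ 2 := by
  set u : ℕ → ℝ := fun p => cos (π / (4 * n p)) ^ n p with hu
  have hu0 : ∀ p, 0 < u p := fun p => lt_of_lt_of_le (by norm_num) (half_le_cos_pow (hn p) le_rfl)
  have hu1 : ∀ p, u p ≤ 1 := fun p =>
    pow_le_one₀ (cos_pi_div_four_mul_mem (hn p)).1 (cos_pi_div_four_mul_mem (hn p)).2
  have hc : 0 < cos (π / 4) := by rw [cos_pi_div_four]; positivity
  have hc2 : cos (π / 4) ^ 2 = 1 / 2 := by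
    rw [cos_pi_div_four, div_pow, sq_sqrt zero_le_two]; norm_num
  -- For s < s₀ the product is empty and the truncated exponent is 0, so the value is r.
  refine ⟨fun s => r * (∏ p ∈ Finset.Ico s₀ s, u p) * cos (π / 4) ^ (s - s₀), by simp, ?_, ?_, ?_⟩
  · intro s
    exact mul_pos (mul_pos hr (Finset.prod_pos fun p _ => hu0 p)) (pow_pos hc _)
  · intro s hs
    have h1 : s + 1 - s₀ = s - s₀ + 1 := by omega
    simp only [Finset.prod_Ico_succ_top hs, h1]
    rw [pow_succ]
    ring
  · intro s hs
    have hprod : 1 / 2 ≤ ∏ p ∈ Finset.Ico s₀ s, u p := by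
      refine le_trans ?_ (one_sub_sum_le_prod (Finset.Ico s₀ s) u (fun p => 1 / (2 * n p : ℝ))
        (fun p => (hu0 p).le) hu1 fun p => one_sub_le_cos_pow (hn p))
      linarith [hsum s]
    obtain ⟨d, rfl⟩ := Nat.exists_eq_add_of_le hs
    set Q := ∏ p ∈ Finset.Ico s₀ (s₀ + d), u p
    have h1 : (2 : ℝ) ^ (s₀ + d) * (r * Q * cos (π / 4) ^ (s₀ + d - s₀)) ^ 2 =
        2 ^ s₀ * (r ^ 2 * Q ^ 2) := by
      rw [Nat.add_sub_cancel_left, mul_pow, ← pow_mul, mul_comm d 2, pow_mul, hc2, pow_add,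
        one_div_pow, mul_pow]
      field_simp
    have h2 : (1 : ℝ) ≤ 2 ^ s₀ := one_le_pow₀ one_le_two
    have h3 : r ^ 2 * (1 / 2) ^ 2 ≤ r ^ 2 * Q ^ 2 := by gcongr
    simp only
    rw [h1]
    nlinarith [sq_nonneg (r * Q)]

/-! ### Necessity: the divergent realization -/

theorem exists_isDictionary_not_converges {H : Type*} [NormedAddCommGroup H]
    [InnerProductSpace ℝ H] [CompleteSpace H] (hinf : ¬ FiniteDimensional ℝ H)
    {t : ℕ → ℝ} (ht : IsWeaknessSequence t) (hmono : ∀ k, 1 ≤ k → t (k + 1) ≤ t k)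
    (h : ¬ Tendsto (fun n : ℕ => ∑ k ∈ Finset.Icc 1 n, t k / (k : ℝ)) atTop atTop) :
    ∃ D : Set H, IsDictionary D ∧ ¬ WGAOctahedronConverges D t := by
  obtain ⟨e, he⟩ := exists_orthonormal_nat H hinf
  obtain ⟨s₀, n, hn, hnt, hsum⟩ := exists_rotation_numbers ht (ht.summable_dyadic hmono h)
  set L := 2 ^ s₀ with hL
  have hLpos : 0 < L := by positivity
  -- Of 3L equal coefficients, L cancellations leave L = 2^s₀, and the step index has then reached
  -- 2^s₀, where splitting can start.
  set r : ℝ := ((3 * L : ℕ) : ℝ)⁻¹ with hr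
  have hrpos : 0 < r := by positivity
  obtain ⟨R, hR0, hRpos, hRs, hRlow⟩ := exists_amplitudes hn s₀ hsum hrpos
  have hRle : ∀ s, s₀ ≤ s → R (s + 1) ≤ R s := fun s hs => by
    obtain ⟨hc0, hc1⟩ := cos_pi_div_four_mul_mem (hn s)
    rw [hRs s hs, mul_assoc]
    refine mul_le_of_le_one_right (hRpos s).le
      (mul_le_one₀ (pow_le_one₀ hc0 hc1) ?_ (Real.cos_le_one _))
    rw [Real.cos_pi_div_four]
    positivity
  have hanti : ∀ m k, 1 ≤ m → m ≤ k → t k ≤ t m := fun m k hm hmk => by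
    induction k, hmk using Nat.le_induction with
    | base => exact le_rfl
    | succ k hk ih => exact (hmono k (hm.trans hk)).trans ih
  refine ⟨planeDictionary e, isDictionary_planeDictionary he, fun hconv => ?_⟩
  set f := ∑ j ∈ Finset.range (3 * L), r • e j with hf
  -- The bound 2^s + i ≤ m, kept because each split costs at least one step, yields t (m + 1) ≤ t
  -- (2^s).
  let Inv : ℕ → H → Prop := fun m g =>
    (m < L ∧ HasCoeffs e g fun j => if j < 3 * L - 2 * m then r else 0) ∨
    ∃ s i k, s₀ ≤ s ∧ i < 2 ^ s ∧ k < n s ∧ 2 ^ s + i ≤ m ∧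
      HasCoeffs e g (splitCoeff (R s) (R (s + 1)) (2 ^ s) i (n s) k)
  have h0 : Inv 0 f := Or.inl ⟨hLpos, hasCoeffs_sum he r (3 * L)⟩
  obtain ⟨φ, hφ, hInv⟩ := exists_realization_of_invariant (D := planeDictionary e) (t := t)
      Inv h0 (by
    rintro m g (⟨hm, hg⟩ | ⟨s, i, k, hs, hi, hk, hm, hg⟩)
    · have h1 : 3 * L - 2 * m = 3 * L - 2 * (m + 1) + 2 := by omega
      have hsup := hg.iSup_le (R := r) fun j => by
        split_ifs
        · rw [abs_of_pos hrpos]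
        · simpa using hrpos.le
      rw [h1] at hg
      obtain ⟨g', hg', hin, hnext⟩ := hg.cancel_pair he
      refine ⟨g', hg', ?_, ?_⟩
      · rw [hin, abs_of_pos (by positivity)]
        obtain ⟨ht0, ht1⟩ := ht (m + 1) (by omega)
        calc _ ≤ t (m + 1) * (√2 * r) := by gcongr
          _ ≤ √2 * r := mul_le_of_le_one_left (by positivity) ht1
      · rcases (show m + 1 ≤ L from hm).lt_or_eq with hlt | heq
        · exact Or.inl ⟨hlt, hnext⟩
        · refine Or.inr ⟨s₀, 0, 0, le_rfl, by positivity, hn s₀, by omega, ?_⟩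
          rw [splitCoeff_start, hR0, ← hL]
          rwa [heq, show 3 * L - 2 * L = L by omega] at hnext
    · have hsup := hg.iSup_le fun j => abs_splitCoeff_le (hn s) (hRpos _).le (hRle s hs) j
      obtain ⟨g', hg', hin, hnext⟩ := hg.rotate he hi
      refine ⟨g', hg', ?_, Or.inr ?_⟩
      · have hc := half_le_cos_pow (hn s) hk.le
        have hsin := one_div_two_mul_le_sin (hn s)
        have hRp := hRpos s
        have hnp : (0 : ℝ) < n s := by exact_mod_cast hn s
        have ht0 := (ht (m + 1) (by omega)).1
        have htm : t (m + 1) ≤ t (2 ^ s) := hanti _ _ Nat.one_le_two_pow (by omega)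
        have h6 := hnt s hs
        have hsqrt : √2 ≤ 3 / 2 := Real.sqrt_le_iff.2 (by norm_num)
        have hlow : R s * (1 / 2) * (1 / (2 * n s)) ≤
            R s * Real.cos (Real.pi / (4 * n s)) ^ k * Real.sin (Real.pi / (4 * n s)) := by
          gcongr
        rw [hin, abs_neg]
        refine le_trans ?_ (hlow.trans (le_abs_self _))
        calc _ ≤ t (m + 1) * (√2 * R s) := by gcongr
          _ ≤ t (m + 1) * (3 / 2 * R s) := by gcongr
          _ = R s * (t (m + 1) * (3 / 2)) := by ring
          -- The constant 6 is 4 · 3/2: the step has size at least R/(4n), and √2 ≤ 3/2.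
          _ ≤ R s * ((1 / n s) * (1 / 4)) := mul_le_mul_of_nonneg_left (by linarith) hRp.le
          _ = _ := by field_simp; norm_num
      · rcases (show k + 1 ≤ n s from hk).lt_or_eq with hlt | heq
        · exact ⟨s, i, k + 1, hs, hi, hlt, by omega, hnext⟩
        rw [heq, splitCoeff_end (hn s) (hRs s hs)] at hnext
        rcases (show i + 1 ≤ 2 ^ s from hi).lt_or_eq with hlt' | heq'
        · exact ⟨s, i + 1, 0, hs, hlt', hn s, by omega, hnext⟩
        rw [heq', splitCoeff_level (R (s + 1 + 1)) (n (s + 1)), ← pow_succ'] at hnext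
        exact ⟨s + 1, 0, 0, by omega, by positivity, hn _, by rw [pow_succ]; omega, hnext⟩)
  have hlim := hconv f (sum_mem_octahedron e (by omega)) φ hφ
  have hlim2 : Tendsto (fun m => ‖wgaResidual f φ m‖ ^ 2) atTop (𝓝 0) := by
    simpa using hlim.pow 2
  have hpos : (0 : ℝ) < r ^ 2 / 8 := by positivity
  obtain ⟨m, hm, hmL⟩ := ((hlim2.eventually (eventually_lt_nhds hpos)).and
    (eventually_ge_atTop L)).exists
  rcases hInv m with ⟨hlt, -⟩ | ⟨s, i, k, hs, hi, hk, -, hg⟩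
  · omega
  -- Only the first 2^s coefficients are counted, half of the 2^(s+1) in `hRlow`; hence r²/8 instead
  -- of r²/4.
  have h1 := hg.card_mul_sq_le he (hRpos (s + 1)).le fun j hj =>
    le_splitCoeff (hn s) hk.le (hRpos s).le (hRs s hs) (hRle s hs) hj
  have h2 := hRlow (s + 1) (by omega)
  rw [pow_succ (2 : ℝ)] at h2
  push_cast at h1
  linarith

theorem theorem6p4 {H : Type*} [NormedAddCommGroup H] [InnerProductSpace ℝ H] [CompleteSpace H]
    (t : ℕ → ℝ) (ht : IsWeaknessSequence t) (hmono : ∀ k, 1 ≤ k → t (k + 1) ≤ t k) :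
    (¬ FiniteDimensional ℝ H →
      (Tendsto (fun n : ℕ => ∑ k ∈ Finset.Icc 1 n, t k / (k : ℝ)) atTop atTop ↔
        ∀ D : Set H, IsDictionary D → WGAOctahedronConverges D t)) ∧
    (Tendsto (fun n : ℕ => ∑ k ∈ Finset.Icc 1 n, t k / (k : ℝ)) atTop atTop →
      ∀ D : Set H, IsDictionary D → WGAOctahedronConverges D t) := by
  refine ⟨fun hinf => ⟨fun h D hD => .of_tendsto hD.1 ht h, fun hall => ?_⟩,
    fun h D hD => .of_tendsto hD.1 ht h⟩
  by_contra h
  obtain ⟨D, hD, hn⟩ := exists_isDictionary_not_converges hinf ht hmono h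
  exact hn (hall D hD)
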